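/- Let $a_n>0$ and $b_n\in\mathbb R$ ($n\in\mathbb Z_+=\{0,1,2,\dots\}$) and let $\mathcal J$ be the Jacobi matrix: $(\mathcal J u)_0=b_0u_0+a_0u_1$ and $(\mathcal J u)_n=a_{n-1}u_{n-1}+b_nu_n+a_nu_{n+1}$ for $n\ge 1$. For $n\ge1$ put $\beta_n=-\dfrac{b_n}{2\sqrt{a_{n-1}a_n}}$ and $k_n=\dfrac{a_n}{\sqrt{a_{n-1}a_{n+1}}}$, and let $\beta_0\in\mathbb R$ be an arbitrary fixed number. Assume that $$\sum_{n}a_n^{-1}<\infty,\qquad \beta_n\to\beta_\infty\ \text{ with } |\beta_\infty|<1,\qquad \sum_n|k_n-1|<\infty,\qquad \sum_n|\beta_{n+1}-\beta_n|<\infty .$$ Set $\varphi_n=\sum\arccos\beta_m$, where the sum is over the $m\in\{0,\dots,n-1\}$ with $|\beta_m|\le1$. Let $p(z)=(p_n(z))$ and $q(z)=(q_n(z))$ be the solutions of the Jacobi equation $$a_{n-1}u_{n-1}+b_nu_n+a_nu_{n+1}=zu_n,\qquad n\ge1,$$ with $p_0=1$, $p_1=(z-b_0)/a_0$, $q_0=0$,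 $q_1=1/a_0$. Let $J_{\max}$ be the operator $u\mapsto\mathcal Ju$ in $\ell^2(\mathbb Z_+)$ with domain $\{u\in\ell^2:\mathcal Ju\in\ell^2\}$. Let $\langle u,v\rangle=\sum_n u_n\bar v_n$. Let $z\in\mathbb C$ with $\operatorname{Im}z\ne0$ and $\omega\in\mathbb C$ with $|\omega|=1$. Then: 1. Every $u\in\mathcal D(J_{\max})$ has an asymptotic expansion $u_n=a_n^{-1/2}\big(s_+e^{i\varphi_n}+s_-e^{-i\varphi_n}+o(1)\big)$ as $n\to\infty$ with unique coefficients $s_\pm=s_\pm(u)\in\mathbb C$. Let $J_\omega$ be the restriction of $J_{\max}$ to $\{u\in\mathcal D(J_{\max}): s_+(u)=\omega s_-(u)\}$. 2. The Jacobi equation has unique solutions $f^{(\pm)}(z)$ (the Jost solutions) with $f^{(\pm)}_n(z)=a_n^{-1/2}e^{\pm i\varphi_n}(1+o(1))$, and there are coefficients such that $$p_n(z)=\sigma_+(z)f_n^{(+)}(z)+\sigma_-(z)f_n^{(-)}(z),\qquad q_n(z)=\tau_+(z)f_n^{(+)}(z)+\tau_-(z)f_n^{(-)}(z)$$ for all $n$.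 These are the asymptotic coefficients of $p(z)$ and $q(z)$: $\sigma_\pm(z)=s_\pm(p(z))$, $\tau_\pm(z)=s_\pm(q(z))$. Moreover $\sigma_+(z)-\omega\sigma_-(z)\ne0$. 3. The sequences $p(z)$, $p(\bar z)$, $q(z)$ belong to $\ell^2(\mathbb Z_+)$; the formula $$(\mathcal R(z)h)_n=q_n(z)\sum_{m=0}^np_m(z)h_m+p_n(z)\sum_{m=n+1}^\infty q_m(z)h_m$$ defines a bounded operator $\mathcal R(z)$ on $\ell^2(\mathbb Z_+)$; and the resolvent $(J_\omega-zI)^{-1}$ exists as a bounded operator on $\ell^2(\mathbb Z_+)$ and is given by $$(J_\omega-zI)^{-1}h=\gamma_\omega(z)\,\langle h,p(\bar z)\rangle\,p(z)+\mathcal R(z)h\quad\text{for all }h\in\ell^2(\mathbb Z_+),\qquad \gamma_\omega(z)=-\frac{\tau_+(z)-\omega\tau_-(z)}{\sigma_+(z)-\omega\sigma_-(z)} .$$ -/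

import Mathlib

open Filter Topology

namespace Jacobi

noncomputable section

/-- The Hilbert space `ℓ²(ℤ₊)`. -/
abbrev H : Type := lp (fun _ : ℕ => ℂ) 2

/-- The formal Jacobi matrix with off-diagonal entries `a` and diagonal entries `b`,
acting on arbitrary sequences. -/
def jacobi (a b : ℕ → ℝ) (u : ℕ → ℂ) : ℕ → ℂ
  | 0 => b 0 * u 0 + a 0 * u 1
  | n + 1 => a n * u n + b (n + 1) * u (n + 1) + a (n + 1) * u (n + 2)

/-- The Jacobi equation `a_{n-1} u_{n-1} + b_n u_n + a_n u_{n+1} = z u_n` for all `n ≥ 1`. -/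
def SolvesJacobi (a b : ℕ → ℝ) (z : ℂ) (u : ℕ → ℂ) : Prop :=
  ∀ n : ℕ, a n * u n + b (n + 1) * u (n + 1) + a (n + 1) * u (n + 2) = z * u (n + 1)

/-- The polynomials of the first kind: the solution with `p_0 = 1`, `p_1 = (z - b_0) / a_0`. -/
def p (a b : ℕ → ℝ) (z : ℂ) : ℕ → ℂ
  | 0 => 1
  | 1 => (z - b 0) / a 0
  | n + 2 => ((z - b (n + 1)) * p a b z (n + 1) - a n * p a b z n) / a (n + 1)

/-- The polynomials of the second kind: the solution with `q_0 = 0`, `q_1 = 1 / a_0`. -/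
def q (a b : ℕ → ℝ) (z : ℂ) : ℕ → ℂ
  | 0 => 0
  | 1 => 1 / a 0
  | n + 2 => ((z - b (n + 1)) * q a b z (n + 1) - a n * q a b z n) / a (n + 1)

theorem jacobi_add (a b : ℕ → ℝ) (u v : ℕ → ℂ) :
    jacobi a b (u + v) = jacobi a b u + jacobi a b v := by
  funext n
  cases n <;> simp [jacobi] <;> ring

theorem jacobi_smul (a b : ℕ → ℝ) (c : ℂ) (u : ℕ → ℂ) :
    jacobi a b (c • u) = c • jacobi a b u := by
  funext n
  cases n <;> simp [jacobi] <;> ring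

/-- The maximal Jacobi operator: `u ↦ 𝒥 u` on all `u ∈ ℓ²` with `𝒥 u ∈ ℓ²`. -/
def Jmax (a b : ℕ → ℝ) : H →ₗ.[ℂ] H where
  domain :=
    { carrier := {u | Memℓp (jacobi a b (u : ℕ → ℂ)) 2}
      zero_mem' := by
        have h : jacobi a b ((0 : H) : ℕ → ℂ) = 0 := by
          funext n
          cases n <;> simp [jacobi]
        rw [Set.mem_ofPred_eq, h]
        exact zero_memℓp
      add_mem' := by
        intro u v hu hv
        rw [Set.mem_ofPred_eq, lp.coeFn_add, jacobi_add]
        exact hu.add hv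
      smul_mem' := by
        intro c u hu
        rw [Set.mem_ofPred_eq, lp.coeFn_smul, jacobi_smul]
        exact hu.const_smul c }
  toFun :=
    { toFun := fun u => ⟨jacobi a b ((u : H) : ℕ → ℂ), u.2⟩
      map_add' := by
        intro u v
        apply lp.ext
        exact jacobi_add a b _ _
      map_smul' := by
        intro c u
        apply lp.ext
        exact jacobi_smul a b c _ }

/-- `β_n = -b_n / (2 √(a_{n-1} a_n))` for `n ≥ 1`. The number `β_0`, for which the formula has
no meaning, is a free parameter `β₀`. -/
def beta (a b : ℕ → ℝ) (β₀ : ℝ) : ℕ → ℝ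
  | 0 => β₀
  | n + 1 => -b (n + 1) / (2 * √(a n * a (n + 1)))

/-- `kSucc a n` is `k_{n+1}`, where `k_m = a_m / √(a_{m-1} a_{m+1})` for `m ≥ 1`. -/
def kSucc (a : ℕ → ℝ) (n : ℕ) : ℝ := a (n + 1) / √(a n * a (n + 2))

/-- The phase `φ_n`: the sum of `arccos β_m` over those `m < n` with `|β_m| ≤ 1`. -/
def phase (a b : ℕ → ℝ) (β₀ : ℝ) (n : ℕ) : ℝ :=
  ∑ m ∈ (Finset.range n).filter (fun m => |beta a b β₀ m| ≤ 1), Real.arccos (beta a b β₀ m)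

/-- `f` is a Jost solution `f^(+)(z)` (for `ε = 1`) or `f^(-)(z)` (for `ε = -1`): it solves the
Jacobi equation and `f_n = a_n^{-1/2} e^{iεφ_n} (1 + o(1))`. -/
def IsJost (a b : ℕ → ℝ) (β₀ ε : ℝ) (z : ℂ) (f : ℕ → ℂ) : Prop :=
  SolvesJacobi a b z f ∧
    Tendsto (fun n : ℕ => (√(a n) : ℂ) * f n * Complex.exp (-(Complex.I * ε * phase a b β₀ n)))
      atTop (𝓝 1)

/-- The asymptotic relation `u_n = a_n^{-1/2} (s₊ e^{iφ_n} + s₋ e^{-iφ_n} + o(1))`. -/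
def HasCoeffs (a b : ℕ → ℝ) (β₀ : ℝ) (u : ℕ → ℂ) (sp sm : ℂ) : Prop :=
  Tendsto (fun n : ℕ => (√(a n) : ℂ) * u n
      - (sp * Complex.exp (Complex.I * phase a b β₀ n)
        + sm * Complex.exp (-(Complex.I * phase a b β₀ n))))
    atTop (𝓝 0)

/-- The boundary condition at infinity `s₊(u) = ω s₋(u)`. -/
def bdry (a b : ℕ → ℝ) (β₀ : ℝ) (ω : ℂ) : Submodule ℂ H where
  carrier := {u | ∃ sp sm : ℂ, HasCoeffs a b β₀ (u : ℕ → ℂ) sp sm ∧ sp = ω * sm}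
  zero_mem' := ⟨0, 0, by simp [HasCoeffs], by simp⟩
  add_mem' := by
    rintro u v ⟨s, t, h, e⟩ ⟨s', t', h', e'⟩
    refine ⟨s + s', t + t', ?_, by rw [e, e']; ring⟩
    have := Tendsto.add h h'
    rw [add_zero] at this
    refine this.congr fun n => ?_
    simp only [lp.coeFn_add, Pi.add_apply]
    ring
  smul_mem' := by
    rintro c u ⟨s, t, h, e⟩
    refine ⟨c * s, c * t, ?_, by rw [e]; ring⟩
    have := Tendsto.const_mul c h
    rw [mul_zero] at this
    refine this.congr fun n => ?_
    simp only [lp.coeFn_smul, Pi.smul_apply, smul_eq_mul]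
    ring

/-- The operator `J_ω`: the restriction of `J_max` to the vectors with `s₊(u) = ω s₋(u)`. -/
def Jomega (a b : ℕ → ℝ) (β₀ : ℝ) (ω : ℂ) : H →ₗ.[ℂ] H :=
  (Jmax a b).domRestrict (bdry a b β₀ ω)

/-- `R` is the resolvent `(T - zI)⁻¹`: a bounded everywhere defined two-sided inverse. -/
def IsResolvent (T : H →ₗ.[ℂ] H) (z : ℂ) (R : H →L[ℂ] H) : Prop :=
  (∀ h : H, ∃ hd : R h ∈ T.domain, T ⟨R h, hd⟩ - z • R h = h) ∧
    ∀ u : T.domain, R (T u - z • (u : H)) = u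

/-- `(𝓡(z) h)_n = q_n(z) ∑_{m ≤ n} p_m(z) h_m + p_n(z) ∑_{m > n} q_m(z) h_m`. -/
def quasiResolvent (a b : ℕ → ℝ) (z : ℂ) (h : ℕ → ℂ) (n : ℕ) : ℂ :=
  q a b z n * ∑ m ∈ Finset.range (n + 1), p a b z m * h m
    + p a b z n * ∑' m : ℕ, q a b z (n + 1 + m) * h (n + 1 + m)

end

end Jacobi

namespace Jacobi

open ComplexConjugate

/-! After the substitution `v n = √(a n) * u n` the Jacobi equation becomes `v (n+2) = 2 β (n+1) v
(n+1) - v n` plus a perturbation with summable coefficients. Variation of constants with the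
unimodular roots `exp (± i arccos β)` and a discrete Gronwall bound then give every solution, and
every element of the maximal domain, its two asymptotic coefficients (`exists_coeffs_of_recurrence`,
`Admissible.exists_hasCoeffs`). All solutions are `O(a^{-1/2})`, hence in `ℓ²`: this is the limit
circle case.

The Wronskian at infinity is a constant times the determinant of coefficients
(`exists_tendsto_wronskian`). With `W(p, q) = 1` this shows that a solution is determined by its
coefficients, which may be prescribed freely; Jost solutions are those with coefficients (1, 0) and
(0, 1). With Green's formula for `p` and its conjugate it gives `σ₊ ≠ ω σ₋` off the real axis.

The quasiresolvent inverts `𝒥 - z` and has coefficients `τ± ∑ p h`; adding the right multiple of `p`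
enforces the boundary condition. Uniqueness holds because `p` itself violates that condition. -/

/-! ### Summable perturbations of a three-term recurrence. -/

/-- Discrete Gronwall: the product of the factors `1 + ε n` stays bounded, so `w` is bounded, its
increments are summable, and `w` is Cauchy. -/
theorem exists_tendsto_of_norm_sub_le {E : Type*} [NormedAddCommGroup E] [CompleteSpace E]
    {w : ℕ → E} {ε g : ℕ → ℝ} (hε0 : ∀ n, 0 ≤ ε n) (hg0 : ∀ n, 0 ≤ g n)
    (hε : Summable ε) (hg : Summable g)
    (h : ∀ᶠ n in atTop, ‖w (n + 1) - w n‖ ≤ ε n * ‖w n‖ + g n) :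
    ∃ L, Tendsto w atTop (𝓝 L) := by
  obtain ⟨N, hN⟩ := eventually_atTop.1 h
  have key : ∀ n, N ≤ n → ‖w n‖ ≤
      (‖w N‖ + ∑ k ∈ Finset.range n, g k) * Real.exp (∑ k ∈ Finset.range n, ε k) := by
    intro n hn
    induction n, hn using Nat.le_induction with
    | base =>
      have h1 : 0 ≤ ∑ k ∈ Finset.range N, g k := Finset.sum_nonneg fun k _ => hg0 k
      have h2 : 1 ≤ Real.exp (∑ k ∈ Finset.range N, ε k) :=
        Real.one_le_exp (Finset.sum_nonneg fun k _ => hε0 k)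
      nlinarith [norm_nonneg (w N), mul_nonneg (norm_nonneg (w N)) (sub_nonneg.2 h2),
        mul_nonneg h1 (zero_le_one.trans h2)]
    | succ n hn ih =>
      rw [Finset.sum_range_succ, Finset.sum_range_succ, ← add_assoc]
      set A := ‖w N‖ + ∑ k ∈ Finset.range n, g k
      set S := ∑ k ∈ Finset.range n, ε k
      have h1 : ‖w (n + 1)‖ ≤ (1 + ε n) * ‖w n‖ + g n := by
        have := norm_add_le (w (n + 1) - w n) (w n)
        rw [sub_add_cancel] at this
        linarith [hN n hn]
      have h2 : 1 ≤ Real.exp (S + ε n) :=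
        Real.one_le_exp (add_nonneg (Finset.sum_nonneg fun k _ => hε0 k) (hε0 n))
      have h3 : (1 + ε n) * ‖w n‖ ≤ Real.exp (ε n) * (A * Real.exp S) :=
        mul_le_mul (by linarith [Real.add_one_le_exp (ε n)]) ih (norm_nonneg _)
          (Real.exp_pos _).le
      have h4 : g n ≤ g n * Real.exp (S + ε n) := le_mul_of_one_le_right (hg0 n) h2
      calc ‖w (n + 1)‖ ≤ Real.exp (ε n) * (A * Real.exp S) + g n * Real.exp (S + ε n) := by
            linarith
        _ = (A + g n) * Real.exp (S + ε n) := by rw [Real.exp_add]; ring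
  set M := (‖w N‖ + ∑' k, g k) * Real.exp (∑' k, ε k)
  have hM : ∀ n, N ≤ n → ‖w n‖ ≤ M := by
    intro n hn
    refine (key n hn).trans ?_
    have h1 := hg.sum_le_tsum (Finset.range n) fun k _ => hg0 k
    have h2 := hε.sum_le_tsum (Finset.range n) fun k _ => hε0 k
    have h3 : 0 ≤ ∑' k, g k := tsum_nonneg hg0
    exact mul_le_mul (by linarith) (Real.exp_le_exp.2 h2) (Real.exp_pos _).le
      (add_nonneg (norm_nonneg _) h3)
  have hc : CauchySeq fun n => w (n + N) := by
    refine cauchySeq_of_dist_le_of_summable (fun n => ε (n + N) * M + g (n + N)) (fun n => ?_)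
      (((summable_nat_add_iff N).2 hε).mul_right M |>.add ((summable_nat_add_iff N).2 hg))
    rw [dist_comm, dist_eq_norm, Nat.succ_eq_add_one, add_right_comm]
    refine (hN (n + N) (by omega)).trans ?_
    have := mul_le_mul_of_nonneg_left (hM (n + N) (by omega)) (hε0 (n + N))
    linarith
  obtain ⟨L, hL⟩ := cauchySeq_tendsto_of_complete hc
  exact ⟨L, (tendsto_add_atTop_iff_nat N).1 hL⟩

/-- One step of the variation of constants for a three-term recurrence whose characteristic
roots are `ζ` and `conj ζ`. -/
theorem norm_variation_step_le {ζ ζ' t' t'' v v' v'' r : ℂ} (hζ' : ‖ζ'‖ = 1)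
    (ht' : ‖t'‖ = 1) (htt : t'' = ζ' * t')
    (hv : v'' = (ζ' + conj ζ') * v' - v + r) :
    ‖(v'' - conj ζ' * v') * conj t'' - (v' - conj ζ * v) * conj t'‖ ≤ ‖ζ' - ζ‖ * ‖v‖ + ‖r‖ := by
  have h1 : ζ' * conj ζ' = 1 := by rw [Complex.mul_conj']; simp [hζ']
  have h2 : (v'' - conj ζ' * v') * conj t'' - (v' - conj ζ * v) * conj t'
      = -(conj (ζ' - ζ) * v * conj t') + r * conj t'' := by
    rw [hv, htt, map_mul, map_sub]
    linear_combination (v' * conj t') * h1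
  have ht'' : ‖t''‖ = 1 := by rw [htt, norm_mul, hζ', ht', one_mul]
  rw [h2]
  refine (norm_add_le _ _).trans ?_
  simp [ht', ht'', -map_sub]

/-- Since `ζ₀` is not real, `ζ - conj ζ` stays away from 0, so `v` is controlled by its two
first-order factors. These converge by Gronwall, and solving back for `v` gives the coefficients. -/
theorem exists_coeffs_of_recurrence {ζ t v r : ℕ → ℂ} {ζ₀ : ℂ} {ε g : ℕ → ℝ}
    (hζ1 : ∀ᶠ n in atTop, ‖ζ n‖ = 1) (ht1 : ∀ n, ‖t n‖ = 1)
    (htt : ∀ᶠ n in atTop, t (n + 1) = ζ n * t n)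
    (hζ : Tendsto ζ atTop (𝓝 ζ₀)) (hζ₀ : ζ₀.im ≠ 0)
    (hdζ : Summable fun n => ‖ζ (n + 1) - ζ n‖)
    (hε0 : ∀ n, 0 ≤ ε n) (hg0 : ∀ n, 0 ≤ g n) (hε : Summable ε) (hg : Summable g)
    (hv : ∀ᶠ n in atTop, v (n + 2) = (ζ (n + 1) + conj (ζ (n + 1))) * v (n + 1) - v n + r n)
    (hr : ∀ᶠ n in atTop, ‖r n‖ ≤ ε n * (‖v (n + 1)‖ + ‖v n‖) + g n) :
    ∃ sp sm : ℂ, Tendsto (fun n => v n - (sp * t n + sm * conj (t n))) atTop (𝓝 0) := by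
  -- `x` annihilates the mode `conj t` and `y` the mode `t`; the unimodular factors make both nearly
  -- constant.
  set x : ℕ → ℂ := fun n => (v (n + 1) - conj (ζ n) * v n) * conj (t (n + 1)) with hx
  set y : ℕ → ℂ := fun n => (v (n + 1) - ζ n * v n) * t (n + 1) with hy
  set d := |ζ₀.im| with hd
  have hd0 : 0 < d := abs_pos.2 hζ₀
  have him : ∀ᶠ n in atTop, d / 2 < |(ζ n).im| :=
    ((Complex.continuous_im.tendsto ζ₀).comp hζ).abs.eventually (lt_mem_nhds (by linarith))
  have hdiff : ∀ n, (ζ n - conj (ζ n)) * v n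
      = x n * t (n + 1) - y n * conj (t (n + 1)) := by
    intro n
    have h1 : t (n + 1) * conj (t (n + 1)) = 1 := by rw [Complex.mul_conj']; simp [ht1]
    simp only [hx, hy]
    linear_combination (-(ζ n - conj (ζ n)) * v n) * h1
  have hvn : ∀ᶠ n in atTop, ‖v n‖ ≤ 2 / d * ‖(x n, y n)‖ := by
    filter_upwards [him] with n hn
    have h1 : ‖ζ n - conj (ζ n)‖ = 2 * |(ζ n).im| := by
      rw [Complex.sub_conj]; simp
    have h2 := congrArg norm (hdiff n)
    rw [norm_mul, h1] at h2
    have h3 := norm_sub_le (x n * t (n + 1)) (y n * conj (t (n + 1)))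
    simp only [norm_mul, ht1, RCLike.norm_conj, mul_one] at h3
    have h4 := norm_fst_le (x n, y n)
    have h5 := norm_snd_le (x n, y n)
    rw [div_mul_eq_mul_div, le_div_iff₀ hd0]
    simp only at h4 h5
    nlinarith [norm_nonneg (v n)]
  have hvn1 : ∀ᶠ n in atTop, ‖v (n + 1)‖ ≤ (1 + 2 / d) * ‖(x n, y n)‖ := by
    filter_upwards [hvn, hζ1] with n hn hz
    have h1 : ‖x n‖ = ‖v (n + 1) - conj (ζ n) * v n‖ := by simp [hx, ht1]
    have h2 := norm_add_le (v (n + 1) - conj (ζ n) * v n) (conj (ζ n) * v n)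
    rw [sub_add_cancel, norm_mul, RCLike.norm_conj, hz, ← h1] at h2
    have h4 := norm_fst_le (x n, y n)
    simp only at h4
    linarith
  have hstep : ∀ᶠ n in atTop, ‖(x (n + 1), y (n + 1)) - (x n, y n)‖
      ≤ (2 / d * ‖ζ (n + 1) - ζ n‖ + (1 + 4 / d) * ε n) * ‖(x n, y n)‖ + g n := by
    filter_upwards [hvn, hvn1, hv, hr, (tendsto_add_atTop_nat 1).eventually hζ1,
      (tendsto_add_atTop_nat 1).eventually htt] with n h1 h2 h3 h4 h5 h6
    have h7 := norm_variation_step_le (ζ := ζ n) h5 (ht1 _) h6 h3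
    -- The recurrence is symmetric in its two roots, so the same estimate with `ζ` and `t`
    -- conjugated (but not `v`) handles `y`.
    have h8 := norm_variation_step_le (ζ := conj (ζ n)) (ζ' := conj (ζ (n + 1)))
      (t' := conj (t (n + 1))) (t'' := conj (t (n + 1 + 1))) (v := v n) (v' := v (n + 1))
      (v'' := v (n + 2)) (r := r n)
      (by simpa using h5) (by simp [ht1]) (by rw [h6, map_mul])
      (by rw [h3, Complex.conj_conj]; ring)
    rw [← map_sub, RCLike.norm_conj] at h8
    simp only [Complex.conj_conj] at h8
    have h9 : ‖ζ (n + 1) - ζ n‖ * ‖v n‖ + ‖r n‖ ≤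
        (2 / d * ‖ζ (n + 1) - ζ n‖ + (1 + 4 / d) * ε n) * ‖(x n, y n)‖ + g n := by
      have e1 := mul_le_mul_of_nonneg_left h1 (norm_nonneg (ζ (n + 1) - ζ n))
      have e2 := mul_le_mul_of_nonneg_left (add_le_add h2 h1) (hε0 n)
      calc _ ≤ ‖ζ (n + 1) - ζ n‖ * (2 / d * ‖(x n, y n)‖) + (ε n * ((1 + 2 / d) * ‖(x n, y n)‖
            + 2 / d * ‖(x n, y n)‖) + g n) := by linarith
        _ = _ := by ring
    rw [Prod.mk_sub_mk, Prod.norm_def]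
    exact (max_le h7 h8).trans h9
  obtain ⟨⟨X, Y⟩, hXY⟩ := exists_tendsto_of_norm_sub_le
    (w := fun n => (x n, y n)) (fun n => add_nonneg (mul_nonneg (by positivity : (0 : ℝ) ≤ 2 / d) (norm_nonneg _))
      (mul_nonneg (by positivity : (0 : ℝ) ≤ 1 + 4 / d) (hε0 n))) hg0
    ((hdζ.mul_left _).add (hε.mul_left _)) hg hstep
  have hX : Tendsto x atTop (𝓝 X) := (continuous_fst.tendsto _).comp hXY
  have hY : Tendsto y atTop (𝓝 Y) := (continuous_snd.tendsto _).comp hXY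
  have hcζ : Tendsto (fun n => conj (ζ n)) atTop (𝓝 (conj ζ₀)) :=
    (Complex.continuous_conj.tendsto ζ₀).comp hζ
  have hsub : ∀ w : ℂ, w.im ≠ 0 → w - conj w ≠ 0 := by
    intro w hw; rw [Complex.sub_conj]; simpa using hw
  have hA : Tendsto (fun n => x n * ζ n / (ζ n - conj (ζ n))) atTop
      (𝓝 (X * ζ₀ / (ζ₀ - conj ζ₀))) := (hX.mul hζ).div (hζ.sub hcζ) (hsub _ hζ₀)
  have hB : Tendsto (fun n => -(y n * conj (ζ n)) / (ζ n - conj (ζ n))) atTop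
      (𝓝 (-(Y * conj ζ₀) / (ζ₀ - conj ζ₀))) :=
    (hY.mul hcζ).neg.div (hζ.sub hcζ) (hsub _ hζ₀)
  refine ⟨X * ζ₀ / (ζ₀ - conj ζ₀), -(Y * conj ζ₀) / (ζ₀ - conj ζ₀), ?_⟩
  have hA' := (tendsto_iff_norm_sub_tendsto_zero.1 hA).add (tendsto_iff_norm_sub_tendsto_zero.1 hB)
  rw [add_zero] at hA'
  refine squeeze_zero_norm' ?_ hA'
  filter_upwards [him, htt] with n h1 h2
  have h3 : ζ n - conj (ζ n) ≠ 0 := hsub _ (fun h => by rw [h, abs_zero] at h1; linarith)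
  have h4 : v n = x n * ζ n / (ζ n - conj (ζ n)) * t n
      + -(y n * conj (ζ n)) / (ζ n - conj (ζ n)) * conj (t n) := by
    have := hdiff n
    rw [h2, map_mul] at this
    field_simp
    linear_combination this
  have h5 : v n - (X * ζ₀ / (ζ₀ - conj ζ₀) * t n + -(Y * conj ζ₀) / (ζ₀ - conj ζ₀) * conj (t n))
      = (x n * ζ n / (ζ n - conj (ζ n)) - X * ζ₀ / (ζ₀ - conj ζ₀)) * t n
      + (-(y n * conj (ζ n)) / (ζ n - conj (ζ n)) - -(Y * conj ζ₀) / (ζ₀ - conj ζ₀))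
        * conj (t n) := by
    rw [h4]; ring
  rw [h5]
  refine (norm_add_le _ _).trans ?_
  simp [ht1]

/-! ### Oscillating factors and asymptotic coefficients. -/

/-- The standing assumptions on the coefficients of the Jacobi matrix. -/
structure Admissible (a b : ℕ → ℝ) (β₀ βinf : ℝ) : Prop where
  pos : ∀ n, 0 < a n
  summable_inv : Summable fun n => (a n)⁻¹
  tendsto_beta : Tendsto (beta a b β₀) atTop (𝓝 βinf)
  abs_lt_one : |βinf| < 1
  summable_k : Summable fun n => |kSucc a n - 1|
  summable_beta : Summable fun n => |beta a b β₀ (n + 1) - beta a b β₀ n|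

/-- The characteristic root `exp (i arccos x)` of `ζ + ζ⁻¹ = 2 x`. -/
noncomputable def root (x : ℝ) : ℂ := Complex.exp (Complex.I * Real.arccos x)

/-- The oscillating factor `exp (i φ_n)`. -/
noncomputable def osc (a b : ℕ → ℝ) (β₀ : ℝ) (n : ℕ) : ℂ :=
  Complex.exp (Complex.I * phase a b β₀ n)

theorem norm_exp_I_mul (x : ℝ) : ‖Complex.exp (Complex.I * x)‖ = 1 := by
  rw [mul_comm, Complex.norm_exp_ofReal_mul_I]

theorem conj_exp_I_mul (x : ℝ) :
    conj (Complex.exp (Complex.I * x)) = Complex.exp (-(Complex.I * x)) := by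
  rw [← Complex.exp_conj]; simp

theorem norm_root (x : ℝ) : ‖root x‖ = 1 := norm_exp_I_mul _

theorem norm_osc (a b : ℕ → ℝ) (β₀ : ℝ) (n : ℕ) : ‖osc a b β₀ n‖ = 1 := norm_exp_I_mul _

/-- Valid for all real `x`: outside [-1, 1] both sides are 0, as `arccos` is constantly 0 or π there
and the square root of a negative number is 0. -/
theorem root_im (x : ℝ) : (root x).im = √(1 - x ^ 2) := by
  rw [root, mul_comm, Complex.exp_ofReal_mul_I_im, Real.sin_arccos]

theorem root_re {x : ℝ} (hx : |x| ≤ 1) : (root x).re = x := by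
  rw [root, mul_comm, Complex.exp_ofReal_mul_I_re,
    Real.cos_arccos (abs_le.1 hx).1 (abs_le.1 hx).2]

theorem continuous_root : Continuous root := by
  unfold root
  have := Real.continuous_arccos
  fun_prop

theorem osc_mul_conj (a b : ℕ → ℝ) (β₀ : ℝ) (n : ℕ) :
    osc a b β₀ n * conj (osc a b β₀ n) = 1 := by
  rw [Complex.mul_conj']; simp [norm_osc]

theorem hasCoeffs_iff {a b : ℕ → ℝ} {β₀ : ℝ} {u : ℕ → ℂ} {sp sm : ℂ} :
    HasCoeffs a b β₀ u sp sm ↔ Tendsto (fun n : ℕ => (√(a n) : ℂ) * u n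
      - (sp * osc a b β₀ n + sm * conj (osc a b β₀ n))) atTop (𝓝 0) := by
  simp only [HasCoeffs, osc, conj_exp_I_mul]

/-- The two normalisations of the remainder differ by a unimodular factor. -/
theorem isJost_one_iff {a b : ℕ → ℝ} {β₀ : ℝ} {z : ℂ} {f : ℕ → ℂ} :
    IsJost a b β₀ 1 z f ↔ SolvesJacobi a b z f ∧ HasCoeffs a b β₀ f 1 0 := by
  refine and_congr_right fun _ => ?_
  rw [hasCoeffs_iff, tendsto_zero_iff_norm_tendsto_zero, tendsto_iff_norm_sub_tendsto_zero]
  refine tendsto_congr fun n => ?_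
  have h := osc_mul_conj a b β₀ n
  have h1 : Complex.exp (-(Complex.I * (1 : ℝ) * phase a b β₀ n)) = conj (osc a b β₀ n) := by
    rw [osc, conj_exp_I_mul]; simp
  rw [h1, ← mul_one ‖_ - (_ + _)‖, ← norm_osc a b β₀ n, ← RCLike.norm_conj (osc a b β₀ n),
    ← norm_mul]
  congr 1
  linear_combination h

theorem isJost_neg_one_iff {a b : ℕ → ℝ} {β₀ : ℝ} {z : ℂ} {f : ℕ → ℂ} :
    IsJost a b β₀ (-1) z f ↔ SolvesJacobi a b z f ∧ HasCoeffs a b β₀ f 0 1 := by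
  refine and_congr_right fun _ => ?_
  rw [hasCoeffs_iff, tendsto_zero_iff_norm_tendsto_zero, tendsto_iff_norm_sub_tendsto_zero]
  refine tendsto_congr fun n => ?_
  have h := osc_mul_conj a b β₀ n
  have h1 : Complex.exp (-(Complex.I * (-1 : ℝ) * phase a b β₀ n)) = osc a b β₀ n := by
    rw [osc]; simp
  rw [h1, ← mul_one ‖_ - (_ + _)‖, ← norm_osc a b β₀ n, ← norm_mul]
  congr 1
  linear_combination h

theorem HasCoeffs.linear {a b : ℕ → ℝ} {β₀ : ℝ} {u w : ℕ → ℂ} {sp sm tp tm : ℂ}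
    (hu : HasCoeffs a b β₀ u sp sm) (hw : HasCoeffs a b β₀ w tp tm) (c d : ℂ) :
    HasCoeffs a b β₀ (fun n => c * u n + d * w n) (c * sp + d * tp) (c * sm + d * tm) := by
  have := (hu.const_mul c).add (hw.const_mul d)
  simp only [mul_zero, add_zero] at this
  refine this.congr fun n => ?_
  ring

theorem HasCoeffs.conj {a b : ℕ → ℝ} {β₀ : ℝ} {u : ℕ → ℂ} {sp sm : ℂ}
    (hu : HasCoeffs a b β₀ u sp sm) :
    HasCoeffs a b β₀ (fun n => conj (u n)) (conj sm) (conj sp) := by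
  rw [hasCoeffs_iff] at hu ⊢
  have := (Complex.continuous_conj.tendsto 0).comp hu
  rw [map_zero] at this
  refine this.congr fun n => ?_
  simp [add_comm]

theorem HasCoeffs.exists_bound {a b : ℕ → ℝ} {β₀ : ℝ} {u : ℕ → ℂ} {sp sm : ℂ}
    (hu : HasCoeffs a b β₀ u sp sm) : ∃ C, ∀ n, ‖(√(a n) : ℂ) * u n‖ ≤ C := by
  rw [hasCoeffs_iff] at hu
  obtain ⟨C, hC⟩ := hu.norm.bddAbove_range
  refine ⟨C + (‖sp‖ + ‖sm‖), fun n => ?_⟩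
  have h1 := hC ⟨n, rfl⟩
  have h2 := norm_add_le (sp * osc a b β₀ n) (sm * Star.star (osc a b β₀ n))
  have h3 := norm_sub_norm_le ((√(a n) : ℂ) * u n)
    (sp * osc a b β₀ n + sm * (starRingEnd ℂ) (osc a b β₀ n))
  simp only [norm_mul, norm_osc, norm_star, mul_one] at h2
  simp only [starRingEnd_apply] at h1 h3
  linarith

/-! ### Consequences of the assumptions on `a` and `b`. -/

namespace Admissible

variable {a b : ℕ → ℝ} {β₀ βinf : ℝ}

theorem eventually_abs_le (h : Admissible a b β₀ βinf) :
    ∀ᶠ n in atTop, |beta a b β₀ n| ≤ 1 :=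
  (h.tendsto_beta.abs.eventually (gt_mem_nhds h.abs_lt_one)).mono fun _ hn => le_of_lt hn

theorem root_im_pos (h : Admissible a b β₀ βinf) : 0 < (root βinf).im := by
  rw [root_im]
  apply Real.sqrt_pos.2
  have := (sq_lt_one_iff_abs_lt_one βinf).2 h.abs_lt_one
  linarith

theorem tendsto_root (h : Admissible a b β₀ βinf) :
    Tendsto (fun n => root (beta a b β₀ n)) atTop (𝓝 (root βinf)) :=
  (continuous_root.tendsto _).comp h.tendsto_beta

theorem osc_succ (h : Admissible a b β₀ βinf) :
    ∀ᶠ n in atTop, osc a b β₀ (n + 1) = root (beta a b β₀ n) * osc a b β₀ n := by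
  filter_upwards [h.eventually_abs_le] with n hn
  have : phase a b β₀ (n + 1) = Real.arccos (beta a b β₀ n) + phase a b β₀ n := by
    rw [phase, phase, Finset.range_add_one, Finset.filter_insert, if_pos hn,
      Finset.sum_insert (by simp)]
  rw [osc, osc, root, this, ← Complex.exp_add]
  push_cast
  ring_nf

/-- The real part of the root is `β` itself; the imaginary part `√(1 - β²)` is Lipschitz in `β` near
`βinf` because `|βinf| < 1`. -/
theorem summable_root (h : Admissible a b β₀ βinf) :
    Summable fun n => ‖root (beta a b β₀ (n + 1)) - root (beta a b β₀ n)‖ := by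
  set c := (root βinf).im with hc
  have hc0 : 0 < c := h.root_im_pos
  have him : ∀ᶠ n in atTop, c / 2 < (root (beta a b β₀ n)).im :=
    ((Complex.continuous_im.tendsto _).comp h.tendsto_root).eventually
      (lt_mem_nhds (by change c / 2 < c; linarith))
  refine Summable.of_norm_bounded_eventually_nat (h.summable_beta.mul_left (1 + 2 / c)) ?_
  filter_upwards [him, h.eventually_abs_le, (tendsto_add_atTop_nat 1).eventually him,
    (tendsto_add_atTop_nat 1).eventually h.eventually_abs_le] with n h1 h2 h3 h4
  set x := beta a b β₀ n
  set y := beta a b β₀ (n + 1)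
  have hx : 0 ≤ 1 - x ^ 2 := by have := (sq_le_one_iff_abs_le_one x).2 h2; linarith
  have hy : 0 ≤ 1 - y ^ 2 := by have := (sq_le_one_iff_abs_le_one y).2 h4; linarith
  rw [norm_norm]
  refine (Complex.norm_le_abs_re_add_abs_im _).trans ?_
  rw [Complex.sub_re, Complex.sub_im, root_re h2, root_re h4, add_mul, one_mul]
  gcongr
  rw [root_im] at h1 h3 ⊢
  rw [root_im, div_mul_eq_mul_div, le_div_iff₀ hc0]
  have e1 : (√(1 - y ^ 2) - √(1 - x ^ 2)) * (√(1 - y ^ 2) + √(1 - x ^ 2))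
      = -((y - x) * (y + x)) := by
    have := Real.sq_sqrt hx
    have := Real.sq_sqrt hy
    nlinarith
  have e2 := congrArg abs e1
  rw [abs_mul, abs_neg, abs_mul, abs_of_pos (a := √(1 - y ^ 2) + √(1 - x ^ 2)) (by linarith)] at e2
  have e3 : |y + x| ≤ 2 := (abs_add_le _ _).trans (by linarith)
  have e4 := mul_le_mul_of_nonneg_left e3 (abs_nonneg (y - x))
  have e5 := mul_le_mul_of_nonneg_left (by linarith : c ≤ √(1 - y ^ 2) + √(1 - x ^ 2))
    (abs_nonneg (√(1 - y ^ 2) - √(1 - x ^ 2)))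
  linarith

theorem summable_inv_sqrt_mul (h : Admissible a b β₀ βinf) :
    Summable fun n => (√(a n))⁻¹ * (√(a (n + 1)))⁻¹ := by
  refine Summable.of_nonneg_of_le (fun n => by positivity) (fun n => ?_)
    (h.summable_inv.add ((summable_nat_add_iff 1).2 h.summable_inv))
  have h1 : ∀ n, ((√(a n))⁻¹) ^ 2 = (a n)⁻¹ := fun n => by
    rw [inv_pow, Real.sq_sqrt (h.pos n).le]
  rw [← h1, ← h1]
  nlinarith [sq_nonneg ((√(a n))⁻¹ - (√(a (n + 1)))⁻¹), sq_nonneg ((√(a n))⁻¹),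
    sq_nonneg ((√(a (n + 1)))⁻¹)]

theorem kSucc_eq (h : Admissible a b β₀ βinf) (n : ℕ) :
    kSucc a n = a (n + 1) / (√(a n) * √(a (n + 2))) := by
  rw [kSucc, Real.sqrt_mul (h.pos n).le]

/-- Consecutive ratios differ by the factor `kSucc a n`, so the increments are `kSucc a n - 1` times
the ratio. -/
theorem exists_tendsto_ratio (h : Admissible a b β₀ βinf) :
    ∃ R : ℝ, Tendsto (fun n => √(a n) / √(a (n + 1))) atTop (𝓝 R) := by
  refine exists_tendsto_of_norm_sub_le (ε := fun n => |kSucc a n - 1|) (g := 0)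
    (fun _ => abs_nonneg _) (fun _ => le_rfl) h.summable_k summable_zero
    (Eventually.of_forall fun n => le_of_eq ?_)
  rw [Pi.zero_apply, add_zero, ← Real.norm_eq_abs, ← norm_mul]
  congr 1
  have h1 := Real.sq_sqrt (h.pos (n + 1)).le
  have h2 := Real.sqrt_pos.2 (h.pos n)
  have h3 := Real.sqrt_pos.2 (h.pos (n + 1))
  have h4 := Real.sqrt_pos.2 (h.pos (n + 2))
  rw [h.kSucc_eq, show n + 1 + 1 = n + 2 from rfl]
  field_simp
  rw [h1]

end Admissible

/-! ### Wronskians and Green's formula. -/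

/-- The Wronskian (Casoratian) of two sequences. -/
def wronskian (a : ℕ → ℝ) (u w : ℕ → ℂ) (n : ℕ) : ℂ :=
  a n * (u n * w (n + 1) - u (n + 1) * w n)

theorem sum_green (a b : ℕ → ℝ) (u w : ℕ → ℂ) (n : ℕ) :
    ∑ m ∈ Finset.range (n + 1), (u m * jacobi a b w m - jacobi a b u m * w m)
      = wronskian a u w n := by
  induction n with
  | zero => simp [jacobi, wronskian]; ring
  | succ n ih =>
    rw [Finset.sum_range_succ, ih]
    simp only [jacobi, wronskian]
    ring

theorem wronskian_succ {a b : ℕ → ℝ} {z : ℂ} {u w : ℕ → ℂ} (hu : SolvesJacobi a b z u)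
    (hw : SolvesJacobi a b z w) (n : ℕ) : wronskian a u w n = wronskian a u w 0 := by
  induction n with
  | zero => rfl
  | succ n ih =>
    rw [← ih]
    simp only [wronskian]
    linear_combination u (n + 1) * hw n - w (n + 1) * hu n

/-! ### Asymptotics of solutions and of their Wronskians. -/

namespace Admissible

variable {a b : ℕ → ℝ} {β₀ βinf : ℝ}

/-- The inhomogeneity `f` lets one argument serve both solutions (`f = 0`) and elements of the
maximal domain (`z = 0`, `f` the shifted `𝒥 u`). -/
theorem exists_hasCoeffs (h : Admissible a b β₀ βinf) {z : ℂ} {u f : ℕ → ℂ}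
    (hu : ∀ n, a n * u n + b (n + 1) * u (n + 1) + a (n + 1) * u (n + 2) = z * u (n + 1) + f n)
    (hf : Summable fun n => (√(a n))⁻¹ * ‖f n‖) :
    ∃ sp sm, HasCoeffs a b β₀ u sp sm := by
  set β := beta a b β₀ with hβ
  set v : ℕ → ℂ := fun n => (√(a n) : ℂ) * u n with hv
  set α : ℕ → ℝ := fun n => (√(a n))⁻¹ * (√(a (n + 1)))⁻¹ with hα
  have hrec : ∀ n, (kSucc a n : ℂ) * v (n + 2)
      = (2 * β (n + 1) + z * α n) * v (n + 1) - v n + (√(a n))⁻¹ * f n := by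
    intro n
    have h0 : (√(a n) : ℂ) ≠ 0 := by exact_mod_cast (Real.sqrt_pos.2 (h.pos n)).ne'
    have h1 : (√(a (n + 1)) : ℂ) ≠ 0 := by exact_mod_cast (Real.sqrt_pos.2 (h.pos (n + 1))).ne'
    have h2 : (√(a (n + 2)) : ℂ) ≠ 0 := by exact_mod_cast (Real.sqrt_pos.2 (h.pos (n + 2))).ne'
    have hs : (√(a n) : ℂ) ^ 2 = a n := by exact_mod_cast Real.sq_sqrt (h.pos n).le
    rw [h.kSucc_eq]
    simp only [hβ, beta, hv, hα]
    rw [Real.sqrt_mul (h.pos n).le]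
    push_cast
    have := hu n
    rw [← hs] at this
    field_simp
    linear_combination this
  set r : ℕ → ℂ := fun n => v (n + 2) - (2 * β (n + 1) * v (n + 1) - v n) with hr
  have hk : ∀ᶠ n in atTop, |kSucc a n - 1| < 1 / 2 :=
    h.summable_k.tendsto_atTop_zero.eventually (gt_mem_nhds (by norm_num))
  have hb : ∀ᶠ n in atTop, |β (n + 1)| ≤ 1 :=
    (tendsto_add_atTop_nat 1).eventually h.eventually_abs_le
  have hα0 : ∀ n, 0 ≤ α n := fun n => by positivity
  have hv' : ∀ᶠ n in atTop, v (n + 2)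
      = (root (β (n + 1)) + conj (root (β (n + 1)))) * v (n + 1) - v n + r n := by
    filter_upwards [hb] with n hn
    rw [Complex.add_conj, root_re hn]
    simp only [hr]
    push_cast
    ring
  have hr' : ∀ᶠ n in atTop, ‖r n‖ ≤ 2 * (‖z‖ * α n + 2 * |kSucc a n - 1|)
      * (‖v (n + 1)‖ + ‖v n‖) + 2 * ((√(a n))⁻¹ * ‖f n‖) := by
    filter_upwards [hb, hk] with n hn hkn
    -- Multiplying by `kSucc a n` eliminates `v (n + 2)`; eventually this factor is at least 1/2,
    -- whence the factors 2 in the bound.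
    have e : (kSucc a n : ℂ) * r n = z * α n * v (n + 1) + (√(a n))⁻¹ * f n
        - ((kSucc a n - 1 : ℝ) : ℂ) * (2 * β (n + 1) * v (n + 1) - v n) := by
      simp only [hr, Complex.ofReal_sub, Complex.ofReal_one]
      linear_combination hrec n
    have e1 := congrArg norm e
    rw [norm_mul, Complex.norm_real, Real.norm_eq_abs] at e1
    have e2 : 1 / 2 ≤ |kSucc a n| := by
      have := (abs_lt.1 hkn).1
      rw [le_abs]; left; linarith
    have e3 := norm_sub_le (z * α n * v (n + 1) + (√(a n))⁻¹ * f n)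
      (((kSucc a n - 1 : ℝ) : ℂ) * (2 * β (n + 1) * v (n + 1) - v n))
    have e4 := norm_add_le (z * α n * v (n + 1)) ((√(a n))⁻¹ * f n)
    have e5 := norm_sub_le (2 * β (n + 1) * v (n + 1)) (v n)
    simp only [norm_mul, norm_inv, Complex.norm_real, Real.norm_eq_abs, abs_of_nonneg (hα0 n),
      abs_of_nonneg (Real.sqrt_nonneg _), Complex.norm_ofNat] at e3 e4 e5
    have e6 : 2 * |β (n + 1)| * ‖v (n + 1)‖ - 2 * ‖v (n + 1)‖ ≤ 0 := by
      nlinarith [norm_nonneg (v (n + 1))]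
    have e7 := mul_le_mul_of_nonneg_left
      (e5.trans (by linarith [norm_nonneg (v n)] : _ ≤ 2 * (‖v (n + 1)‖ + ‖v n‖)))
      (abs_nonneg (kSucc a n - 1))
    have e8 := mul_le_mul_of_nonneg_right e2 (norm_nonneg (r n))
    have e9 : 0 ≤ ‖z‖ * α n * ‖v n‖ := by have := hα0 n; positivity
    nlinarith
  obtain ⟨sp, sm, hs⟩ := exists_coeffs_of_recurrence (ζ := fun n => root (β n))
    (t := osc a b β₀) (v := v) (r := r)
    (ε := fun n => 2 * (‖z‖ * α n + 2 * |kSucc a n - 1|))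
    (g := fun n => 2 * ((√(a n))⁻¹ * ‖f n‖))
    (Eventually.of_forall fun n => norm_root _) (norm_osc a b β₀) h.osc_succ h.tendsto_root
    h.root_im_pos.ne' h.summable_root
    (fun n => by have := hα0 n; positivity) (fun n => by positivity)
    (((h.summable_inv_sqrt_mul.mul_left _).add (h.summable_k.mul_left _)).mul_left _)
    (hf.mul_left _) hv' hr'
  exact ⟨sp, sm, hasCoeffs_iff.2 hs⟩

/-- The Wronskian at infinity is a multiple of the determinant of asymptotic coefficients. -/
theorem exists_tendsto_wronskian (h : Admissible a b β₀ βinf) :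
    ∃ κ : ℂ, ∀ {u w : ℕ → ℂ} {sp sm tp tm : ℂ}, HasCoeffs a b β₀ u sp sm →
      HasCoeffs a b β₀ w tp tm →
      Tendsto (wronskian a u w) atTop (𝓝 (κ * (sp * tm - sm * tp))) := by
  obtain ⟨R, hR⟩ := h.exists_tendsto_ratio
  refine ⟨R * (conj (root βinf) - root βinf), fun {u w sp sm tp tm} hu hw => ?_⟩
  obtain ⟨C, hC⟩ := hw.exists_bound
  rw [hasCoeffs_iff] at hu hw
  set t := osc a b β₀ with ht
  set V : ℕ → ℂ := fun n => (√(a n) : ℂ) * u n with hV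
  set W : ℕ → ℂ := fun n => (√(a n) : ℂ) * w n with hW
  set x : ℕ → ℂ := fun n => sp * t n + sm * conj (t n) with hx
  set y : ℕ → ℂ := fun n => tp * t n + tm * conj (t n) with hy
  have hxb : ∀ n, ‖x n‖ ≤ ‖sp‖ + ‖sm‖ := fun n => by
    refine (norm_add_le _ _).trans ?_
    simp [ht, norm_osc]
  have hu1 := hu.comp (tendsto_add_atTop_nat 1)
  have hw1 := hw.comp (tendsto_add_atTop_nat 1)
  have hbd : ∀ (g : ℕ → ℂ) (K : ℝ), (∀ n, ‖g n‖ ≤ K) →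
      IsBoundedUnder (· ≤ ·) atTop ((‖·‖) ∘ g) := fun g K hg =>
    isBoundedUnder_of ⟨K, hg⟩
  -- The Wronskian is `√(a n) / √(a (n+1))` times `V n * W (n+1) - V (n+1) * W n`. Replacing `V`,
  -- `W` by their leading terms `x`, `y` costs only products of null and bounded sequences.
  have h1 : Tendsto (fun n => (V n - x n) * W (n + 1)) atTop (𝓝 0) :=
    hu.zero_mul_isBoundedUnder_le (hbd _ C fun n => hC (n + 1))
  have h2 : Tendsto (fun n => (V (n + 1) - x (n + 1)) * W n) atTop (𝓝 0) :=
    hu1.zero_mul_isBoundedUnder_le (hbd _ C hC)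
  have h3 : Tendsto (fun n => (W (n + 1) - y (n + 1)) * x n) atTop (𝓝 0) :=
    hw1.zero_mul_isBoundedUnder_le (hbd _ _ hxb)
  have h4 : Tendsto (fun n => (W n - y n) * x (n + 1)) atTop (𝓝 0) :=
    hw.zero_mul_isBoundedUnder_le (hbd _ _ fun n => hxb (n + 1))
  have h5 : Tendsto (fun n => (sp * tm - sm * tp) *
      (conj (root (beta a b β₀ n)) - root (beta a b β₀ n))) atTop
      (𝓝 ((sp * tm - sm * tp) * (conj (root βinf) - root βinf))) :=
    (((Complex.continuous_conj.tendsto _).comp h.tendsto_root).sub h.tendsto_root).const_mul _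
  have hR' : Tendsto (fun n => ((√(a n) / √(a (n + 1)) : ℝ) : ℂ)) atTop (𝓝 (R : ℂ)) :=
    (Complex.continuous_ofReal.tendsto R).comp hR
  have h6 := hR'.mul (((h1.sub h2).add (h3.sub h4)).add h5)
  have e : (R : ℂ) * (0 - 0 + (0 - 0) + (sp * tm - sm * tp) * (conj (root βinf) - root βinf))
      = R * (conj (root βinf) - root βinf) * (sp * tm - sm * tp) := by ring
  rw [e] at h6
  refine h6.congr' ?_
  filter_upwards [h.osc_succ] with n hn
  have e1 : x n * y (n + 1) - x (n + 1) * y n = (sp * tm - sm * tp) *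
      (conj (root (beta a b β₀ n)) - root (beta a b β₀ n)) := by
    have := osc_mul_conj a b β₀ n
    simp only [hx, hy, ht]
    rw [hn, map_mul]
    linear_combination ((sp * tm - sm * tp) *
      (conj (root (beta a b β₀ n)) - root (beta a b β₀ n))) * this
  rw [← e1]
  have h0 : (√(a n) : ℂ) ^ 2 = a n := by exact_mod_cast Real.sq_sqrt (h.pos n).le
  have h7 : (√(a (n + 1)) : ℂ) ≠ 0 := by exact_mod_cast (Real.sqrt_pos.2 (h.pos (n + 1))).ne'
  rw [wronskian, ← h0]
  simp only [hV, hW]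
  push_cast
  field_simp
  ring

/-- If `x e^{iφ} + y e^{-iφ}` tends to 0, multiplying by the root and subtracting the shifted
sequence removes `x` and leaves `y` times a factor with nonzero limit modulus. Conjugation exchanges
the roles of `x` and `y`. -/
theorem hasCoeffs_unique (h : Admissible a b β₀ βinf) {u : ℕ → ℂ} {sp sm tp tm : ℂ}
    (hs : HasCoeffs a b β₀ u sp sm) (ht : HasCoeffs a b β₀ u tp tm) : sp = tp ∧ sm = tm := by
  have key : ∀ x y : ℂ, Tendsto (fun n => x * osc a b β₀ n + y * conj (osc a b β₀ n))
      atTop (𝓝 0) → y = 0 := by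
    intro x y hxy
    have h1 := (h.tendsto_root.mul hxy).sub (hxy.comp (tendsto_add_atTop_nat 1))
    have h2 : Tendsto (fun n => y * (root (beta a b β₀ n) - conj (root (beta a b β₀ n))))
        atTop (𝓝 (y * (root βinf - conj (root βinf)))) :=
      (h.tendsto_root.sub ((Complex.continuous_conj.tendsto _).comp h.tendsto_root)).const_mul _
    have h3 : Tendsto (fun n => y * (root (beta a b β₀ n) - conj (root (beta a b β₀ n))))
        atTop (𝓝 0) := by
      rw [mul_zero, sub_zero] at h1
      rw [tendsto_zero_iff_norm_tendsto_zero] at h1 ⊢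
      refine h1.congr' ?_
      filter_upwards [h.osc_succ] with n hn
      rw [← mul_one ‖y * _‖, ← norm_osc a b β₀ n, ← RCLike.norm_conj (osc a b β₀ n),
        ← norm_mul]
      simp only [Function.comp_apply, hn, map_mul]
      congr 1
      ring
    have h4 := tendsto_nhds_unique h2 h3
    rw [Complex.sub_conj] at h4
    simpa [h.root_im_pos.ne'] using h4
  rw [hasCoeffs_iff] at hs ht
  have h0 := ht.sub hs
  rw [sub_zero] at h0
  have h1 : Tendsto (fun n => (sp - tp) * osc a b β₀ n + (sm - tm) * conj (osc a b β₀ n))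
      atTop (𝓝 0) := h0.congr fun n => by ring
  have h2 : Tendsto (fun n => conj (sm - tm) * osc a b β₀ n
      + conj (sp - tp) * conj (osc a b β₀ n)) atTop (𝓝 0) := by
    have := (Complex.continuous_conj.tendsto 0).comp h1
    rw [map_zero] at this
    refine this.congr fun n => ?_
    simp [add_comm]
  have h3 := key _ _ h1
  have h4 := key _ _ h2
  rw [map_eq_zero] at h4
  exact ⟨sub_eq_zero.1 h4, sub_eq_zero.1 h3⟩

end Admissible

/-! ### The solutions `p` and `q`. -/

section Solutions

variable {a b : ℕ → ℝ} {z : ℂ}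

theorem solvesJacobi_p (ha : ∀ n, 0 < a n) (z : ℂ) : SolvesJacobi a b z (p a b z) := by
  intro n
  have h : (a (n + 1) : ℂ) ≠ 0 := by exact_mod_cast (ha (n + 1)).ne'
  rw [p, mul_div_cancel₀ _ h]
  ring

theorem solvesJacobi_q (ha : ∀ n, 0 < a n) (z : ℂ) : SolvesJacobi a b z (q a b z) := by
  intro n
  have h : (a (n + 1) : ℂ) ≠ 0 := by exact_mod_cast (ha (n + 1)).ne'
  rw [q, mul_div_cancel₀ _ h]
  ring

theorem jacobi_p (ha : ∀ n, 0 < a n) (z : ℂ) (n : ℕ) :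
    jacobi a b (p a b z) n = z * p a b z n := by
  cases n with
  | zero =>
    have h : (a 0 : ℂ) ≠ 0 := by exact_mod_cast (ha 0).ne'
    simp only [jacobi, p]
    rw [mul_div_cancel₀ _ h]
    ring
  | succ n => exact solvesJacobi_p ha z n

theorem conj_p (z : ℂ) : ∀ n, conj (p a b z n) = p a b (conj z) n
  | 0 => by simp [p]
  | 1 => by simp [p]
  | n + 2 => by simp [p, conj_p z n, conj_p z (n + 1)]

theorem wronskian_p_q (ha : ∀ n, 0 < a n) (z : ℂ) (n : ℕ) :
    wronskian a (p a b z) (q a b z) n = 1 := by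
  have h : (a 0 : ℂ) ≠ 0 := by exact_mod_cast (ha 0).ne'
  rw [wronskian_succ (solvesJacobi_p ha z) (solvesJacobi_q ha z)]
  simp [wronskian, p, q, h]

theorem SolvesJacobi.linear {u w : ℕ → ℂ} (hu : SolvesJacobi a b z u)
    (hw : SolvesJacobi a b z w) (c d : ℂ) : SolvesJacobi a b z fun n => c * u n + d * w n := by
  intro n
  linear_combination c * hu n + d * hw n

theorem SolvesJacobi.ext (ha : ∀ n, 0 < a n) {u w : ℕ → ℂ} (hu : SolvesJacobi a b z u)
    (hw : SolvesJacobi a b z w) (h0 : u 0 = w 0) (h1 : u 1 = w 1) : u = w := by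
  have key : ∀ n, u n = w n ∧ u (n + 1) = w (n + 1) := by
    intro n
    induction n with
    | zero => exact ⟨h0, h1⟩
    | succ n ih =>
      refine ⟨ih.2, ?_⟩
      have h : (a (n + 1) : ℂ) ≠ 0 := by exact_mod_cast (ha (n + 1)).ne'
      apply mul_left_cancel₀ h
      linear_combination hu n - hw n - a n * ih.1 + (z - b (n + 1)) * ih.2
  exact funext fun n => (key n).1

/-- Row 0 fixes `u 1` in terms of `u 0`. The zero summand gives the shape expected by
`SolvesJacobi.linear` and `HasCoeffs.linear`. -/
theorem eq_mul_p_of_jacobi_eq (ha : ∀ n, 0 < a n) {u : ℕ → ℂ}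
    (hu : ∀ n, jacobi a b u n = z * u n) : u = fun n => u 0 * p a b z n + 0 * p a b z n := by
  refine SolvesJacobi.ext ha (fun n => hu (n + 1))
    ((solvesJacobi_p ha z).linear (solvesJacobi_p ha z) _ _) (by simp [p]) ?_
  have h : (a 0 : ℂ) ≠ 0 := by exact_mod_cast (ha 0).ne'
  have := hu 0
  simp only [jacobi] at this
  simp only [p]
  field_simp
  linear_combination this

end Solutions

/-! ### Solutions and their asymptotic coefficients. -/

namespace Admissible

variable {a b : ℕ → ℝ} {β₀ βinf : ℝ}

theorem exists_hasCoeffs_of_solvesJacobi (h : Admissible a b β₀ βinf) {z : ℂ} {u : ℕ → ℂ}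
    (hu : SolvesJacobi a b z u) : ∃ sp sm, HasCoeffs a b β₀ u sp sm :=
  h.exists_hasCoeffs (f := 0) (fun n => by simpa using hu n) (by simp)

theorem exists_hasCoeffs_of_mem_domain (h : Admissible a b β₀ βinf) {u : H}
    (hu : u ∈ (Jmax a b).domain) : ∃ sp sm, HasCoeffs a b β₀ u sp sm := by
  have hu' : Memℓp (jacobi a b (u : ℕ → ℂ)) 2 := hu
  refine h.exists_hasCoeffs (z := 0) (f := fun n => jacobi a b u (n + 1))
    (fun n => by simp [jacobi]) ?_
  have h1 : Summable fun n => ‖jacobi a b (u : ℕ → ℂ) n‖ ^ 2 := by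
    simpa using hu'.summable (by simp)
  refine Summable.of_nonneg_of_le (fun n => by positivity) (fun n => ?_)
    (h.summable_inv.add ((summable_nat_add_iff 1).2 h1))
  have h2 : ((√(a n))⁻¹) ^ 2 = (a n)⁻¹ := by rw [inv_pow, Real.sq_sqrt (h.pos n).le]
  rw [← h2]
  nlinarith [sq_nonneg ((√(a n))⁻¹ - ‖jacobi a b (u : ℕ → ℂ) (n + 1)‖),
    sq_nonneg ((√(a n))⁻¹), sq_nonneg ‖jacobi a b (u : ℕ → ℂ) (n + 1)‖]

theorem memℓp_of_hasCoeffs (h : Admissible a b β₀ βinf) {u : ℕ → ℂ} {sp sm : ℂ}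
    (hu : HasCoeffs a b β₀ u sp sm) : Memℓp u 2 := by
  obtain ⟨C, hC⟩ := hu.exists_bound
  apply memℓp_gen
  simp only [ENNReal.toReal_ofNat, Real.rpow_ofNat]
  refine Summable.of_nonneg_of_le (fun n => by positivity) (fun n => ?_)
    (h.summable_inv.mul_left (C ^ 2))
  have h1 := pow_le_pow_left₀ (norm_nonneg _) (hC n) 2
  rw [norm_mul, mul_pow, Complex.norm_real, Real.norm_eq_abs, sq_abs,
    Real.sq_sqrt (h.pos n).le] at h1
  rw [← div_eq_mul_inv, le_div_iff₀ (h.pos n)]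
  linarith

theorem det_ne_zero (h : Admissible a b β₀ βinf) {z σp σm τp τm : ℂ}
    (hp : HasCoeffs a b β₀ (p a b z) σp σm) (hq : HasCoeffs a b β₀ (q a b z) τp τm) :
    σp * τm - σm * τp ≠ 0 := by
  obtain ⟨κ, hκ⟩ := h.exists_tendsto_wronskian
  have h1 := hκ hp hq
  rw [funext (wronskian_p_q h.pos z)] at h1
  have h2 := tendsto_nhds_unique h1 tendsto_const_nhds
  intro h3
  simp [h3] at h2

/-- The difference has zero coefficients, so its constant Wronskians with `p` and `q` vanish; at
index 0 this kills both initial values. -/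
theorem eq_of_hasCoeffs (h : Admissible a b β₀ βinf) {z sp sm : ℂ} {u w : ℕ → ℂ}
    (hu : SolvesJacobi a b z u) (hw : SolvesJacobi a b z w)
    (hus : HasCoeffs a b β₀ u sp sm) (hws : HasCoeffs a b β₀ w sp sm) : u = w := by
  obtain ⟨κ, hκ⟩ := h.exists_tendsto_wronskian
  have hd := hu.linear hw 1 (-1)
  have hds := hus.linear hws 1 (-1)
  have key : ∀ g, SolvesJacobi a b z g →
      wronskian a (fun n => 1 * u n + -1 * w n) g 0 = 0 := by
    intro g hg
    obtain ⟨tp, tm, hgs⟩ := h.exists_hasCoeffs_of_solvesJacobi hg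
    have h1 := hκ hds hgs
    rw [funext (wronskian_succ hd hg)] at h1
    rw [← tendsto_nhds_unique h1 tendsto_const_nhds]
    ring
  have ha : (a 0 : ℂ) ≠ 0 := by exact_mod_cast (h.pos 0).ne'
  have h0 : u 0 = w 0 := by
    have := key _ (solvesJacobi_q h.pos z)
    simp only [wronskian, q, zero_add] at this
    field_simp at this
    linear_combination this
  have h1 : u 1 = w 1 := by
    have := key _ (solvesJacobi_p h.pos z)
    simp only [wronskian, p, zero_add, mul_one, h0] at this
    have h2 := (mul_eq_zero.1 this).resolve_left ha
    linear_combination -h2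
  exact hu.ext h.pos hw h0 h1

/-- A solution with prescribed asymptotic coefficients. -/
theorem existsUnique_of_coeffs (h : Admissible a b β₀ βinf) (z sp sm : ℂ) :
    ∃! f, SolvesJacobi a b z f ∧ HasCoeffs a b β₀ f sp sm := by
  obtain ⟨σp, σm, hp⟩ := h.exists_hasCoeffs_of_solvesJacobi (solvesJacobi_p h.pos z)
  obtain ⟨τp, τm, hq⟩ := h.exists_hasCoeffs_of_solvesJacobi (solvesJacobi_q h.pos z)
  have hD := h.det_ne_zero hp hq
  -- Cramer's rule for the combination of `p` and `q` with coefficients `sp`, `sm`.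
  have hsol := (solvesJacobi_p (b := b) h.pos z).linear (solvesJacobi_q h.pos z)
    ((sp * τm - sm * τp) / (σp * τm - σm * τp)) ((σp * sm - σm * sp) / (σp * τm - σm * τp))
  have hcoeff := hp.linear hq
    ((sp * τm - sm * τp) / (σp * τm - σm * τp)) ((σp * sm - σm * sp) / (σp * τm - σm * τp))
  have e1 : (sp * τm - sm * τp) / (σp * τm - σm * τp) * σp
      + (σp * sm - σm * sp) / (σp * τm - σm * τp) * τp = sp := by
    rw [div_mul_eq_mul_div, div_mul_eq_mul_div, ← add_div, div_eq_iff hD]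
    ring
  have e2 : (sp * τm - sm * τp) / (σp * τm - σm * τp) * σm
      + (σp * sm - σm * sp) / (σp * τm - σm * τp) * τm = sm := by
    rw [div_mul_eq_mul_div, div_mul_eq_mul_div, ← add_div, div_eq_iff hD]
    ring
  rw [e1, e2] at hcoeff
  exact ⟨_, ⟨hsol, hcoeff⟩, fun f hf => h.eq_of_hasCoeffs hf.1 hsol hf.2 hcoeff⟩

/-- Equality would force `|σp| = |σm|`, so the Wronskian of `p` and `conj p` would tend to 0. By
Green's formula it is `(conj z - z) ∑ |p|²`, of modulus at least `|conj z - z|` because `p 0 = 1`.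
-/
theorem coeff_sub_ne_zero (h : Admissible a b β₀ βinf) {z ω σp σm : ℂ} (hω : ‖ω‖ = 1)
    (hz : z.im ≠ 0) (hp : HasCoeffs a b β₀ (p a b z) σp σm) : σp - ω * σm ≠ 0 := by
  intro h0
  obtain ⟨κ, hκ⟩ := h.exists_tendsto_wronskian
  have h1 := hκ hp hp.conj
  have hωω : ω * conj ω = 1 := by rw [Complex.mul_conj']; simp [hω]
  have e : κ * (σp * conj σp - σm * conj σm) = 0 := by
    rw [sub_eq_zero.1 h0, map_mul]
    linear_combination κ * σm * conj σm * hωω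
  rw [e] at h1
  have hW : ∀ n, wronskian a (p a b z) (fun n => conj (p a b z n)) n
      = (conj z - z) * ((∑ m ∈ Finset.range (n + 1), ‖p a b z m‖ ^ 2 : ℝ) : ℂ) := by
    intro n
    rw [← sum_green a b, Complex.ofReal_sum, Finset.mul_sum]
    refine Finset.sum_congr rfl fun m _ => ?_
    have h2 : jacobi a b (fun n => conj (p a b z n)) m = conj z * conj (p a b z m) := by
      simp only [conj_p]
      exact jacobi_p h.pos _ m
    rw [h2, jacobi_p h.pos, Complex.ofReal_pow, ← Complex.mul_conj']
    ring
  have hlow : ∀ n, ‖conj z - z‖ ≤ ‖wronskian a (p a b z) (fun n => conj (p a b z n)) n‖ := by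
    intro n
    rw [hW, norm_mul, Complex.norm_real, Real.norm_eq_abs]
    refine le_mul_of_one_le_right (norm_nonneg _) (le_abs.2 (Or.inl ?_))
    have := Finset.single_le_sum (f := fun m => ‖p a b z m‖ ^ 2) (fun m _ => by positivity)
      (Finset.mem_range.2 n.succ_pos)
    simpa [p] using this
  have h3 := ge_of_tendsto' h1.norm hlow
  rw [norm_zero, norm_le_zero_iff, sub_eq_zero, Complex.conj_eq_iff_im] at h3
  exact hz h3

end Admissible

/-! ### Boundedness of the Green kernel operator. -/

section Volterra

theorem summable_norm_mul_norm (f g : H) : Summable fun n => ‖f n‖ * ‖g n‖ :=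
  lp.summable_mul (by rw [Real.holderConjugate_iff]; norm_num) f g

theorem tsum_norm_mul_norm_le (f g : H) : ∑' n, ‖f n‖ * ‖g n‖ ≤ ‖f‖ * ‖g‖ :=
  lp.tsum_mul_le_mul_norm' (by rw [Real.holderConjugate_iff]; norm_num) f g

theorem summable_mul (f g : H) : Summable fun n => f n * g n :=
  Summable.of_norm (by simpa only [norm_mul] using summable_norm_mul_norm f g)

theorem summable_mul_nat_add (f g : H) (n : ℕ) : Summable fun m => f (n + m) * g (n + m) :=
  (summable_mul f g).comp_injective (add_right_injective n)

/-- The kernel operator with kernel `Q_n P_m` for `m ≤ n` and `P_n Q_m` for `m > n`. -/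
noncomputable def greenSum (P Q h : ℕ → ℂ) (n : ℕ) : ℂ :=
  Q n * ∑ m ∈ Finset.range (n + 1), P m * h m + P n * ∑' m, Q (n + 1 + m) * h (n + 1 + m)

theorem norm_greenSum_le (P Q h : H) (n : ℕ) :
    ‖greenSum P Q h n‖ ≤ ‖h‖ * (‖P‖ * ‖Q n‖ + ‖Q‖ * ‖P n‖) := by
  have h1 : ‖∑ m ∈ Finset.range (n + 1), P m * h m‖ ≤ ‖P‖ * ‖h‖ := by
    refine (norm_sum_le _ _).trans (le_trans ?_ (tsum_norm_mul_norm_le P h))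
    simp only [norm_mul]
    exact (summable_norm_mul_norm P h).sum_le_tsum _ fun m _ => by positivity
  have h2 : ‖∑' m, Q (n + 1 + m) * h (n + 1 + m)‖ ≤ ‖Q‖ * ‖h‖ := by
    have hs : Summable fun m => ‖Q (n + 1 + m)‖ * ‖h (n + 1 + m)‖ :=
      (summable_norm_mul_norm Q h).comp_injective (add_right_injective (n + 1))
    refine (norm_tsum_le_tsum_norm (by simpa only [norm_mul] using hs)).trans
      (le_trans ?_ (tsum_norm_mul_norm_le Q h))
    simp only [norm_mul]
    exact tsum_comp_le_tsum_of_inj (summable_norm_mul_norm Q h) (fun m => by positivity)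
      (add_right_injective (n + 1))
  refine (norm_add_le _ _).trans ?_
  rw [norm_mul, norm_mul]
  have h3 := mul_le_mul_of_nonneg_left h1 (norm_nonneg (Q n))
  have h4 := mul_le_mul_of_nonneg_left h2 (norm_nonneg (P n))
  linarith

/-- By Cauchy–Schwarz the output is dominated by `‖h‖` times the fixed `ℓ²` sequence `G`, which
gives both membership in `ℓ²` and the norm bound. -/
theorem exists_greenOperator (P Q : H) :
    ∃ R : H →L[ℂ] H, ∀ (h : H) (n : ℕ), R h n = greenSum P Q h n := by
  let absQ : lp (fun _ : ℕ => ℝ) 2 := ⟨fun n => ‖Q n‖, (lp.memℓp Q).norm⟩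
  let absP : lp (fun _ : ℕ => ℝ) 2 := ⟨fun n => ‖P n‖, (lp.memℓp P).norm⟩
  let G : lp (fun _ : ℕ => ℝ) 2 := ‖P‖ • absQ + ‖Q‖ • absP
  have hG : ∀ (h : H) n, ‖greenSum P Q h n‖ ≤ (‖h‖ • G) n := fun h n => norm_greenSum_le P Q h n
  let L : H →ₗ[ℂ] H :=
    { toFun := fun h => ⟨greenSum P Q h, (lp.memℓp (‖h‖ • G)).mono (hG h)⟩
      map_add' := by
        intro f g
        apply lp.ext
        funext n
        change greenSum P Q (fun n => f n + g n) n = greenSum P Q f n + greenSum P Q g n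
        simp only [greenSum, mul_add, Finset.sum_add_distrib]
        rw [(summable_mul_nat_add Q f (n + 1)).tsum_add (summable_mul_nat_add Q g (n + 1))]
        ring
      map_smul' := by
        intro c f
        apply lp.ext
        funext n
        change greenSum P Q (fun n => c * f n) n = c * greenSum P Q f n
        simp only [greenSum, mul_left_comm _ c, ← Finset.mul_sum, tsum_mul_left]
        ring }
  refine ⟨L.mkContinuous ‖G‖ fun h => ?_, fun h n => rfl⟩
  calc ‖L h‖ ≤ ‖‖h‖ • G‖ :=
        lp.norm_mono (by simp) fun n => (hG h n).trans (Real.le_norm_self _)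
    _ = ‖G‖ * ‖h‖ := by rw [norm_smul, norm_norm, mul_comm]

end Volterra

/-! ### The quasiresolvent: equation and asymptotics. -/

/-- Variation of constants: the terms gained and lost by the two sums leave the Wronskian of `p` and
`q`, which is 1, times `h n`. -/
theorem jacobi_quasiResolvent {a b : ℕ → ℝ} (ha : ∀ n, 0 < a n) {z : ℂ} {h : ℕ → ℂ}
    (hs : ∀ n, Summable fun m => q a b z (n + m) * h (n + m)) (n : ℕ) :
    jacobi a b (quasiResolvent a b z h) n = z * quasiResolvent a b z h n + h n := by
  set T : ℕ → ℂ := fun n => ∑' m, q a b z (n + m) * h (n + m) with hT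
  set A : ℕ → ℂ := fun n => ∑ m ∈ Finset.range (n + 1), p a b z m * h m with hA
  have hTs : ∀ n, T n = q a b z n * h n + T (n + 1) := by
    intro n
    simp only [hT]
    rw [(hs n).tsum_eq_zero_add, add_zero]
    simp only [add_assoc, add_comm 1]
  have hAs : ∀ n, A (n + 1) = A n + p a b z (n + 1) * h (n + 1) := fun n =>
    Finset.sum_range_succ _ _
  have hR : ∀ n, quasiResolvent a b z h n = q a b z n * A n + p a b z n * T (n + 1) :=
    fun n => rfl
  have hW : ∀ n, a n * (p a b z n * q a b z (n + 1) - p a b z (n + 1) * q a b z n) = 1 :=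
    wronskian_p_q ha z
  cases n with
  | zero =>
    have h0 : A 0 = h 0 := by simp [hA, p]
    have h1 := jacobi_p ha (b := b) z 0
    have h2 := hW 0
    have hp0 : p a b z 0 = 1 := rfl
    have hq0 : q a b z 0 = 0 := rfl
    simp only [jacobi, hR, zero_add] at h1 ⊢
    have h3 := hAs 0
    have h4 := hTs 1
    rw [zero_add] at h3 h2
    rw [h3, h4, h0, hq0]
    rw [hq0, hp0] at h2
    rw [hp0] at h1 ⊢
    rw [show 1 + 1 = 2 from rfl]
    linear_combination (T 2 + q a b z 1 * h 1) * h1 + h 0 * h2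
  | succ n =>
    have hp := solvesJacobi_p ha (b := b) z n
    have hq := solvesJacobi_q ha (b := b) z n
    simp only [jacobi, hR]
    rw [hAs (n + 1), hAs n, hTs (n + 1), hTs (n + 1 + 1)]
    simp only [show n + 1 + 1 = n + 2 from rfl, show n + 2 + 1 = n + 3 from rfl]
    linear_combination (A n + p a b z (n + 1) * h (n + 1)) * hq
      + (q a b z (n + 2) * h (n + 2) + T (n + 3)) * hp + h (n + 1) * hW n

/-- The partial sums converge and the tail vanishes, while `p` and `q` are `O(a^{-1/2})`; only `q`
times the full sum survives. -/
theorem hasCoeffs_quasiResolvent {a b : ℕ → ℝ} {β₀ : ℝ} {z σp σm τp τm : ℂ} {h : ℕ → ℂ}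
    (hp : HasCoeffs a b β₀ (p a b z) σp σm) (hq : HasCoeffs a b β₀ (q a b z) τp τm)
    (hsp : Summable fun m => p a b z m * h m) :
    HasCoeffs a b β₀ (quasiResolvent a b z h) (τp * ∑' m, p a b z m * h m)
      (τm * ∑' m, p a b z m * h m) := by
  obtain ⟨Cp, hCp⟩ := hp.exists_bound
  obtain ⟨Cq, hCq⟩ := hq.exists_bound
  rw [HasCoeffs] at hq ⊢
  set S := ∑' m, p a b z m * h m with hS
  have h1 : Tendsto (fun n => ∑ m ∈ Finset.range (n + 1), p a b z m * h m - S) atTop (𝓝 0) := by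
    have := (hsp.hasSum.tendsto_sum_nat.comp (tendsto_add_atTop_nat 1)).sub_const S
    rwa [← hS, sub_self] at this
  have h2 : Tendsto (fun n => ∑' m, q a b z (n + 1 + m) * h (n + 1 + m)) atTop (𝓝 0) := by
    refine ((tendsto_sum_nat_add fun m => q a b z m * h m).comp
      (tendsto_add_atTop_nat 1)).congr fun n => ?_
    simp only [Function.comp_apply, add_comm]
  have h3 := h1.zero_mul_isBoundedUnder_le (isBoundedUnder_of ⟨Cq, hCq⟩)
  have h4 := h2.zero_mul_isBoundedUnder_le (isBoundedUnder_of ⟨Cp, hCp⟩)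
  have h5 := (h3.add h4).add (hq.const_mul S)
  simp only [mul_zero, add_zero] at h5
  refine h5.congr fun n => ?_
  rw [quasiResolvent]
  ring

/-! ### The resolvent of `J_ω`. -/

namespace Admissible

variable {a b : ℕ → ℝ} {β₀ βinf : ℝ}

theorem eq_zero_of_jacobi_eq (h : Admissible a b β₀ βinf) {z ω σp σm : ℂ}
    (hp : HasCoeffs a b β₀ (p a b z) σp σm) (hne : σp - ω * σm ≠ 0) {u : H}
    (hb : u ∈ bdry a b β₀ ω) (hu : ∀ n, jacobi a b u n = z * u n) : u = 0 := by
  obtain ⟨sp, sm, hs, e⟩ := hb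
  have h1 := eq_mul_p_of_jacobi_eq h.pos hu
  rw [h1] at hs
  obtain ⟨e1, e2⟩ := h.hasCoeffs_unique hs (hp.linear hp _ _)
  have h2 : u 0 * (σp - ω * σm) = 0 := by linear_combination e - e1 + ω * e2
  have h3 := (mul_eq_zero.1 h2).resolve_right hne
  apply lp.ext
  rw [h1, h3]
  funext n
  simp

theorem isResolvent (h : Admissible a b β₀ βinf) {z ω σp σm τp τm : ℂ}
    (hp : HasCoeffs a b β₀ (p a b z) σp σm) (hq : HasCoeffs a b β₀ (q a b z) τp τm)
    (hne : σp - ω * σm ≠ 0) {P Pbar Q : H} (hP : ∀ n, P n = p a b z n)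
    (hPbar : ∀ n, Pbar n = p a b (conj z) n) (hQ : ∀ n, Q n = q a b z n) {Rq : H →L[ℂ] H}
    (hRq : ∀ (f : H) (n : ℕ), Rq f n = quasiResolvent a b z (f : ℕ → ℂ) n) :
    IsResolvent (Jomega a b β₀ ω) z
      ((-((τp - ω * τm) / (σp - ω * σm))) • InnerProductSpace.rankOne ℂ P Pbar + Rq) := by
  set γ := -((τp - ω * τm) / (σp - ω * σm)) with hγ
  set R := γ • InnerProductSpace.rankOne ℂ P Pbar + Rq with hR
  have hRn : ∀ (f : H) n, R f n = γ * (∑' m, p a b z m * f m) * p a b z n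
      + 1 * quasiResolvent a b z f n := by
    intro f n
    -- The conjugate of `p(z̄)` is `p(z)`, so the pairing contains no conjugation.
    have e : inner ℂ Pbar f = ∑' m, p a b z m * f m := by
      rw [lp.inner_eq_tsum]
      refine tsum_congr fun m => ?_
      rw [hPbar, ← conj_p, RCLike.inner_apply, Complex.conj_conj, mul_comm]
    have : R f = γ • (inner ℂ Pbar f • P) + Rq f := rfl
    rw [this, lp.coeFn_add, Pi.add_apply, lp.coeFn_smul, Pi.smul_apply, lp.coeFn_smul,
      Pi.smul_apply, e, hRq, hP, smul_eq_mul, smul_eq_mul]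
    ring
  have hJ : ∀ (f : H) n, jacobi a b (R f) n = z * R f n + f n := by
    intro f n
    have hs : ∀ n, Summable fun m => q a b z (n + m) * f (n + m) := fun n => by
      simpa only [hQ] using summable_mul_nat_add Q f n
    have e : (R f : ℕ → ℂ) = (γ * ∑' m, p a b z m * f m) • p a b z
        + (quasiResolvent a b z f) := by
      funext k
      rw [hRn, one_mul]; rfl
    rw [e, jacobi_add, jacobi_smul]
    simp only [Pi.add_apply, Pi.smul_apply, smul_eq_mul]
    rw [jacobi_p h.pos, jacobi_quasiResolvent h.pos hs]
    ring
  have hB : ∀ f : H, R f ∈ bdry a b β₀ ω := by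
    intro f
    have hs : Summable fun m => p a b z m * f m := by
      simpa only [hP] using summable_mul P f
    have hc := hp.linear (hasCoeffs_quasiResolvent hp hq hs) (γ * ∑' m, p a b z m * f m) 1
    rw [← funext (hRn f)] at hc
    refine ⟨_, _, hc, ?_⟩
    -- This is the boundary condition for the coefficients `(γ σ± + τ±) ∑ p f` of `R f`, and it
    -- dictates `γ`.
    have hγ' : γ * (σp - ω * σm) = -(τp - ω * τm) := by
      rw [hγ, neg_mul, div_mul_cancel₀ _ hne]
    linear_combination (∑' m, p a b z m * f m) * hγ'
  have hD : ∀ f : H, R f ∈ (Jomega a b β₀ ω).domain := by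
    intro f
    refine ⟨hB f, ?_⟩
    change Memℓp (jacobi a b (R f : ℕ → ℂ)) 2
    rw [funext (hJ f)]
    exact lp.memℓp (z • R f + f)
  refine ⟨fun f => ⟨hD f, ?_⟩, fun u => ?_⟩
  · apply lp.ext
    funext n
    change jacobi a b (R f) n - z * R f n = f n
    rw [hJ]
    ring
  -- `R (T u - z u) - u` satisfies the boundary condition and the homogeneous equation including row
  -- 0, so it vanishes.
  · rw [← sub_eq_zero]
    refine h.eq_zero_of_jacobi_eq hp hne (Submodule.sub_mem _ (hB _) u.2.1) fun n => ?_
    set f := Jomega a b β₀ ω u - z • (u : H) with hf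
    have e : ((R f - u : H) : ℕ → ℂ) = (R f : ℕ → ℂ) + (-1 : ℂ) • ((u : H) : ℕ → ℂ) := by
      funext k
      simp [sub_eq_add_neg]
    have e2 : f n = jacobi a b ((u : H) : ℕ → ℂ) n - z * (u : H) n := rfl
    rw [e, jacobi_add, jacobi_smul]
    simp only [Pi.add_apply, Pi.smul_apply, smul_eq_mul]
    rw [hJ, e2]
    ring

end Admissible

end Jacobi

theorem theorem3p10 (a b : ℕ → ℝ) (β₀ βinf : ℝ)
    (ha : ∀ n, 0 < a n)
    (hCarl : Summable fun n => (a n)⁻¹)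
    (hβ : Tendsto (Jacobi.beta a b β₀) atTop (𝓝 βinf)) (hβinf : |βinf| < 1)
    (hk : Summable fun n => |Jacobi.kSucc a n - 1|)
    (hβ' : Summable fun n => |Jacobi.beta a b β₀ (n + 1) - Jacobi.beta a b β₀ n|)
    (ω : ℂ) (hω : ‖ω‖ = 1) (z : ℂ) (hz : z.im ≠ 0) :
    -- the asymptotic coefficients `s₊(u)`, `s₋(u)` are well defined on the domain of `J_max`
    (∀ u ∈ (Jacobi.Jmax a b).domain,
      ∃! s : ℂ × ℂ, Jacobi.HasCoeffs a b β₀ (u : ℕ → ℂ) s.1 s.2) ∧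
    -- the Jost solutions `f⁺(z)`, `f⁻(z)` exist and are unique
    (∃! f : ℕ → ℂ, Jacobi.IsJost a b β₀ 1 z f) ∧
    (∃! f : ℕ → ℂ, Jacobi.IsJost a b β₀ (-1) z f) ∧
    ∃ fp fm : ℕ → ℂ, Jacobi.IsJost a b β₀ 1 z fp ∧ Jacobi.IsJost a b β₀ (-1) z fm ∧
    ∃ σp σm τp τm : ℂ,
      (∀ n, Jacobi.p a b z n = σp * fp n + σm * fm n) ∧
      (∀ n, Jacobi.q a b z n = τp * fp n + τm * fm n) ∧
      Jacobi.HasCoeffs a b β₀ (Jacobi.p a b z) σp σm ∧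
      Jacobi.HasCoeffs a b β₀ (Jacobi.q a b z) τp τm ∧
      σp - ω * σm ≠ 0 ∧
      -- `p(z)`, `p(z̄)`, `q(z)` belong to `ℓ²`, so that the series below converge
      ∃ P Pbar Q : Jacobi.H,
        (∀ n, P n = Jacobi.p a b z n) ∧
        (∀ n, Pbar n = Jacobi.p a b (starRingEnd ℂ z) n) ∧
        (∀ n, Q n = Jacobi.q a b z n) ∧
        -- `𝓡(z)` is a bounded operator on `ℓ²`
        ∃ Rq : Jacobi.H →L[ℂ] Jacobi.H,
          (∀ (h : Jacobi.H) (n : ℕ), Rq h n = Jacobi.quasiResolvent a b z (h : ℕ → ℂ) n) ∧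
          -- the resolvent of `J_ω` at `z` is `γ_ω(z) ⟨·, p(z̄)⟩ p(z) + 𝓡(z)`
          Jacobi.IsResolvent (Jacobi.Jomega a b β₀ ω) z
            ((-((τp - ω * τm) / (σp - ω * σm))) • InnerProductSpace.rankOne ℂ P Pbar + Rq) := by
  have h : Jacobi.Admissible a b β₀ βinf := ⟨ha, hCarl, hβ, hβinf, hk, hβ'⟩
  obtain ⟨fp, ⟨hfp, hfps⟩, hfpu⟩ := h.existsUnique_of_coeffs z 1 0
  obtain ⟨fm, ⟨hfm, hfms⟩, hfmu⟩ := h.existsUnique_of_coeffs z 0 1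
  have decomp : ∀ u, Jacobi.SolvesJacobi a b z u → ∃ sp sm : ℂ,
      (∀ n, u n = sp * fp n + sm * fm n) ∧ Jacobi.HasCoeffs a b β₀ u sp sm := by
    intro u hu
    obtain ⟨sp, sm, hs⟩ := h.exists_hasCoeffs_of_solvesJacobi hu
    refine ⟨sp, sm, congrFun (h.eq_of_hasCoeffs hu (hfp.linear hfm sp sm) hs ?_), hs⟩
    simpa using hfps.linear hfms sp sm
  obtain ⟨σp, σm, hpf, hp⟩ := decomp _ (Jacobi.solvesJacobi_p ha z)
  obtain ⟨τp, τm, hqf, hq⟩ := decomp _ (Jacobi.solvesJacobi_q ha z)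
  -- These coefficients serve only to put `p(z̄)` in `ℓ²`.
  obtain ⟨ρp, ρm, hpbar⟩ := h.exists_hasCoeffs_of_solvesJacobi
    (Jacobi.solvesJacobi_p ha (starRingEnd ℂ z))
  have hne := h.coeff_sub_ne_zero hω hz hp
  refine ⟨fun u hu => ?_, ⟨fp, Jacobi.isJost_one_iff.2 ⟨hfp, hfps⟩,
      fun f hf => hfpu f (Jacobi.isJost_one_iff.1 hf)⟩,
    ⟨fm, Jacobi.isJost_neg_one_iff.2 ⟨hfm, hfms⟩,
      fun f hf => hfmu f (Jacobi.isJost_neg_one_iff.1 hf)⟩,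
    fp, fm, Jacobi.isJost_one_iff.2 ⟨hfp, hfps⟩, Jacobi.isJost_neg_one_iff.2 ⟨hfm, hfms⟩,
    σp, σm, τp, τm, hpf, hqf, hp, hq, hne, ?_⟩
  · obtain ⟨sp, sm, hs⟩ := h.exists_hasCoeffs_of_mem_domain hu
    refine ⟨(sp, sm), hs, fun t ht => ?_⟩
    obtain ⟨e1, e2⟩ := h.hasCoeffs_unique ht hs
    exact Prod.ext e1 e2
  · let P : Jacobi.H := ⟨Jacobi.p a b z, h.memℓp_of_hasCoeffs hp⟩
    let Q : Jacobi.H := ⟨Jacobi.q a b z, h.memℓp_of_hasCoeffs hq⟩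
    let Pbar : Jacobi.H := ⟨Jacobi.p a b (starRingEnd ℂ z), h.memℓp_of_hasCoeffs hpbar⟩
    obtain ⟨Rq, hRq⟩ := Jacobi.exists_greenOperator P Q
    exact ⟨P, Pbar, Q, fun _ => rfl, fun _ => rfl, fun _ => rfl, Rq, hRq,
      h.isResolvent (P := P) (Pbar := Pbar) (Q := Q) hp hq hne (fun _ => rfl) (fun _ => rfl)
        (fun _ => rfl) hRq⟩
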